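/- Let $C$ be a closed convex subset of a Banach space $(X,\|\cdot\|)$ and let $T:C\to C$ be nonexpansive. Let $(x_n)_{n\ge 0}$ satisfy $$x_{n+1}=(1-\alpha_{n+1})x_n+\alpha_{n+1}(Tx_n+e_{n+1}),\qquad n\ge 0,$$ with $\alpha_n\in[0,1]$ and $e_n\in X$ for $n\ge 1$. Assume that there is $\kappa\in[0,\infty)$ such that $x_n\in C$ and $\|Tx_n-x_0\|\le\kappa$ for all $n\ge 0$, that $\sum_{k\ge1}\|e_k\|<\infty$, and that $\alpha_n$ is bounded away from $0$ and $1$ (that is, there is $c>0$ with $c\le\alpha_n\le 1-c$ for all $n\ge 1$). Then there exists a constant $\nu\ge 0$ such that for all $n\ge 1$ $$\|x_n-Tx_n\|\le\frac{\nu}{\sqrt n}+\sum_{i\ge\lfloor n/2\rfloor,\ i\ge 1}2\|e_i\|.$$ Moreover, with the same $\nu$, if $\varphi:[0,\infty)\to[0,\infty)$ is nondecreasing and $\mu=\sum_{k\ge1}\varphi(k)\|e_k\|<\infty$, then $$\|x_n-Tx_n\|\le\frac{\nu}{\sqrt n}+\frac{2\mu}{\varphi(\lfloor n/2\rfloor)}$$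 for all $n\ge1$ with $\varphi(\lfloor n/2\rfloor)>0$. In particular, if $\sum_{k\ge1}k^a\|e_k\|<\infty$ for some $a\ge0$, then $\|x_n-Tx_n\|=O(1/n^b)$ as $n\to\infty$, with $b=\min\{\tfrac12,a\}$. -/

import Mathlib

open Filter Asymptotics
open scoped NNReal

/-- The inexact Krasnosel'skii-Mann iteration
`x_{n+1} = (1 - α_{n+1}) x_n + α_{n+1} (T x_n + e_{n+1})`, `n ≥ 0`.
Only the values of `α` and `e` at indices `≥ 1` occur. -/
def IsInexactKM {X : Type*} [NormedAddCommGroup X] [NormedSpace ℝ X]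
    (T : X → X) (α : ℕ → ℝ) (e x : ℕ → X) : Prop :=
  ∀ n : ℕ, x (n + 1) = (1 - α (n + 1)) • x n + α (n + 1) • (T (x n) + e (n + 1))

/-- All the iterates lie in `C`, and their images under `T` stay within a finite distance `κ`
of the starting point. -/
def AssumptionH0 {X : Type*} [NormedAddCommGroup X]
    (C : Set X) (T : X → X) (x : ℕ → X) : Prop :=
  ∃ κ : ℝ, 0 ≤ κ ∧ ∀ n : ℕ, x n ∈ C ∧ ‖T (x n) - x 0‖ ≤ κ

/-- The step sizes `α_n`, `n ≥ 1`, are bounded away from `0` and from `1`. -/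
def BoundedAwayFromZeroOne (α : ℕ → ℝ) : Prop :=
  ∃ c : ℝ, 0 < c ∧ ∀ n : ℕ, 1 ≤ n → c ≤ α n ∧ α n ≤ 1 - c

/-!
The proof compares the inexact iteration with exact ones and then reduces the exact iteration to
a random walk.

*Restarting.* For `m = ⌊n/2⌋` let `y` be the exact iteration started at `x m`, with the steps
`α (m+1), α (m+2), …`. Since `T` is nonexpansive, each step increases the distance between `y` and
`x` by at most the norm of the current error, so `x n` is within `∑_{m < i ≤ n} ‖e i‖` of
`y (n - m)`, and the residual of `x n` exceeds that of `y (n - m)` by at most twice this sum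
(`IsInexactKM.norm_sub_exactKM_le`). It remains to bound the residual of an exact iteration by a
multiple of `1 / √n`, uniformly in the starting point.

*Exact iterations.* Let `h n s` be the probability that a walk on `ℕ`, started at `s` and killed at
`0`, survives the `n` steps with indices `n, n - 1, …, 1`, where step `i` is `+1` or `-1` with
probability `α i (1 - α i)` each and `0` otherwise (`survival`). If the distance of `y 0` from every
`T (y j)` is at most `K`, then `‖y n - T (y n)‖ ≤ K * h n 1` (`norm_sub_map_le_survival`). Indeed,
unfolding `y i = (1 - α i) y (i-1) + α i T (y (i-1))` in both arguments of `‖y m - y n‖` amounts to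
two independent players who at each index `i` "fall" with probability `α i`; when both have fallen,
`T` is cancelled by nonexpansiveness. The lead of the first player over the second, counted in
falls, performs the walk above, and the norm vanishes as soon as the lead does. The averages
`leadAverage` of `h` over the falls of the first player turn this into two inequalities that are
proved simultaneously by induction.

*Survival.* With `L n = √(4 + ε n)`, the parabola `2 (s / L) (2 - s / L)` is a supersolution of the
recursion for `h` as long as it is less than `1`: its second difference in `s` is `-4 / L ^ 2`, which
outweighs its decrease in `n` if `ε ≤ 2 α i (1 - α i)` for all `i`. Hence
`h n 1 ≤ 4 / L n = O(1 / √n)` (`survival_le_parabola`).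
-/

/-! ### Survival of a lazy random walk -/

/-- The probability `survival α n s` that a walk started at `s` and killed at `0` survives `n`
steps, the first of which goes to `s + 1` and to `s - 1` with probability `α n * (1 - α n)` each and
stays at `s` otherwise. The later steps use `α (n - 1), …, α 1`. -/
noncomputable def survival (α : ℕ → ℝ) : ℕ → ℕ → ℝ
  | 0, 0 => 0
  | 0, _ + 1 => 1
  | _ + 1, 0 => 0
  | n + 1, s + 1 =>
      (1 - 2 * (α (n + 1) * (1 - α (n + 1)))) * survival α n (s + 1)
        + α (n + 1) * (1 - α (n + 1)) * (survival α n s + survival α n (s + 2))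

@[simp] lemma survival_zero_right (α : ℕ → ℝ) (n : ℕ) : survival α n 0 = 0 := by
  cases n <;> simp [survival]

@[simp] lemma survival_zero_succ (α : ℕ → ℝ) (s : ℕ) : survival α 0 (s + 1) = 1 := by
  simp [survival]

lemma survival_succ_succ (α : ℕ → ℝ) (n s : ℕ) :
    survival α (n + 1) (s + 1) =
      (1 - 2 * (α (n + 1) * (1 - α (n + 1)))) * survival α n (s + 1)
        + α (n + 1) * (1 - α (n + 1)) * (survival α n s + survival α n (s + 2)) := by
  rw [survival]

lemma survival_le_one {α : ℕ → ℝ} (h₀ : ∀ n, 0 ≤ α (n + 1)) (h₁ : ∀ n, α (n + 1) ≤ 1)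
    (n s : ℕ) : survival α n s ≤ 1 := by
  induction n generalizing s with
  | zero => cases s <;> simp
  | succ n ih =>
    cases s with
    | zero => simp
    | succ s =>
      rw [survival_succ_succ]
      have hp : 0 ≤ α (n + 1) * (1 - α (n + 1)) := mul_nonneg (h₀ n) (by linarith [h₁ n])
      have hq : 0 ≤ 1 - 2 * (α (n + 1) * (1 - α (n + 1))) := by
        nlinarith [sq_nonneg (2 * α (n + 1) - 1)]
      nlinarith [mul_le_mul_of_nonneg_left (ih (s + 1)) hq,
        mul_le_mul_of_nonneg_left (add_le_add (ih s) (ih (s + 2))) hp]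

/-- The parabola decreases by at most `2 * ε / L ^ 2` when `L ^ 2` grows by `ε`. -/
lemma parabola_sub_le {s L L' ε : ℝ} (hs : 0 ≤ s) (hsL : s ≤ L) (hL : 0 < L) (hLL' : L ≤ L')
    (hε : L' ^ 2 = L ^ 2 + ε) :
    2 * (s / L) * (2 - s / L) - 2 * ε / L ^ 2 ≤ 2 * (s / L') * (2 - s / L') := by
  have hL' : 0 < L' := hL.trans_le hLL'
  have hu : s / L' ≤ s / L := div_le_div_of_nonneg_left hs hL hLL'
  have hu' : 0 ≤ s / L' := by positivity
  have key : s / L - s / L' ≤ ε / (2 * L ^ 2) := by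
    rw [div_sub_div _ _ hL.ne' hL'.ne', div_le_div_iff₀ (by positivity) (by positivity)]
    have h1 : ε = (L' - L) * (L' + L) := by linarith
    have h2 : s * (L * 2) ≤ (L' + L) * L' := by
      nlinarith [mul_le_mul hsL hLL' hL.le hL.le, mul_nonneg hL.le (sub_nonneg.2 hLL')]
    have h3 : 0 ≤ L * (L' - L) := mul_nonneg hL.le (sub_nonneg.2 hLL')
    rw [h1]
    nlinarith [mul_le_mul_of_nonneg_left h2 h3]
  have h4 : 2 * ε / L ^ 2 = 4 * (ε / (2 * L ^ 2)) := by field_simp; ring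
  have h5 : 0 ≤ s / L := hu'.trans hu
  nlinarith [mul_le_mul hu hu hu' h5]

/-- The survival probability is at most a parabola of width of order `√n`. -/
lemma survival_le_parabola {α : ℕ → ℝ} {ε : ℝ} (hε : 0 ≤ ε)
    (h₀ : ∀ n, 0 ≤ α (n + 1)) (h₁ : ∀ n, α (n + 1) ≤ 1)
    (hα : ∀ n, ε ≤ 2 * (α (n + 1) * (1 - α (n + 1)))) (n s : ℕ)
    (hs : (s : ℝ) ≤ √(4 + ε * n)) :
    survival α n s ≤ 2 * (s / √(4 + ε * n)) * (2 - s / √(4 + ε * n)) := by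
  -- the parabola is at least `1` as soon as `s / L` is at least `1 / 3`
  have large : ∀ t : ℝ, 1 / 3 ≤ t → t ≤ 1 → 1 ≤ 2 * t * (2 - t) := fun t h h' => by nlinarith
  induction n generalizing s with
  | zero =>
    have h4 : √(4 + ε * ((0 : ℕ) : ℝ)) = 2 := by
      rw [show (4 : ℝ) + ε * ((0 : ℕ) : ℝ) = 2 ^ 2 by norm_num]; exact Real.sqrt_sq (by norm_num)
    rw [h4] at hs ⊢
    cases s with
    | zero => simp
    | succ s =>
      rw [survival_zero_succ]
      push_cast at hs ⊢
      have : (0 : ℝ) ≤ s := s.cast_nonneg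
      exact large _ (by linarith) (by linarith)
  | succ n ih =>
    cases s with
    | zero => simp
    | succ s =>
      have hn : (0 : ℝ) ≤ n := n.cast_nonneg
      have hs0 : (0 : ℝ) ≤ s := s.cast_nonneg
      set L := √(4 + ε * (n : ℝ))
      set L' := √(4 + ε * ((n + 1 : ℕ) : ℝ)) with hL'def
      have hL2 : L ^ 2 = 4 + ε * n := Real.sq_sqrt (by positivity)
      have hL'2 : L' ^ 2 = L ^ 2 + ε := by
        rw [hL2, hL'def, Real.sq_sqrt (by positivity)]; push_cast; ring
      have hLpos : 0 ≤ L := Real.sqrt_nonneg _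
      have hL'pos : 0 ≤ L' := Real.sqrt_nonneg _
      have hLge : 2 ≤ L := by nlinarith [mul_nonneg hε hn]
      have hLL' : L ≤ L' := by nlinarith
      have hε' : ε ≤ 1 / 2 := by nlinarith [hα 0, sq_nonneg (2 * α (0 + 1) - 1)]
      push_cast at hs ⊢
      by_cases hsL : (s : ℝ) + 2 ≤ L
      · have i0 := ih s (by linarith)
        have i1 := ih (s + 1) (by push_cast; linarith)
        have i2 := ih (s + 2) (by push_cast; linarith)
        push_cast at i0 i1 i2
        rw [survival_succ_succ]
        have hd := parabola_sub_le (s := s + 1) (by positivity) (by linarith)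
          (by linarith : (0 : ℝ) < L) hLL' hL'2
        have hp := hα n
        have hp0 : 0 ≤ α (n + 1) * (1 - α (n + 1)) := by linarith
        have hq : 0 ≤ 1 - 2 * (α (n + 1) * (1 - α (n + 1))) := by
          nlinarith [sq_nonneg (2 * α (n + 1) - 1)]
        generalize α (n + 1) * (1 - α (n + 1)) = p at hp hp0 hq ⊢
        have hstep := add_le_add (mul_le_mul_of_nonneg_left i1 hq)
          (mul_le_mul_of_nonneg_left (add_le_add i0 i2) hp0)
        refine hstep.trans (le_trans ?_ hd)
        -- the second difference of the parabola is `-4 / L ^ 2`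
        have hid : (1 - 2 * p) * (2 * ((s + 1) / L) * (2 - (s + 1) / L))
            + p * (2 * (s / L) * (2 - s / L) + 2 * ((s + 2) / L) * (2 - (s + 2) / L))
            = 2 * ((s + 1) / L) * (2 - (s + 1) / L) - 2 * (2 * p) / L ^ 2 := by
          have : L ≠ 0 := by linarith
          field_simp
          ring
        rw [hid]
        gcongr
      · -- near the vertex the recursion would involve points beyond it, but there the parabola
        -- already exceeds `1`
        have : survival α (n + 1) (s + 1) ≤ 1 := survival_le_one h₀ h₁ _ _
        refine this.trans (large _ ?_ ?_)
        · rw [le_div_iff₀ (by linarith)]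
          nlinarith
        · rw [div_le_one (by linarith)]
          exact hs

/-! ### Exact iterations -/

/-- The average of `survival α m (s + N)` over the number `N` of falls at the indices
`m + 1, …, m + k`, where a fall at `i` has probability `α i`, independently. -/
noncomputable def leadAverage (α : ℕ → ℝ) (m : ℕ) : ℕ → ℕ → ℝ
  | 0, s => survival α m s
  | k + 1, s => (1 - α (m + k + 1)) * leadAverage α m k s
      + α (m + k + 1) * leadAverage α m k (s + 1)

lemma leadAverage_zero_succ (α : ℕ → ℝ) (k s : ℕ) : leadAverage α 0 k (s + 1) = 1 := by
  induction k generalizing s with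
  | zero => simp [leadAverage]
  | succ k ih => rw [leadAverage, ih, ih]; ring

/-- Conditioning on whether the second player falls at `m + 1`. -/
lemma leadAverage_succ_succ (α : ℕ → ℝ) (m k s : ℕ) :
    leadAverage α (m + 1) k (s + 1) =
      (1 - α (m + 1)) * leadAverage α m (k + 1) (s + 1)
        + α (m + 1) * leadAverage α m (k + 1) s := by
  induction k generalizing s with
  | zero => simp only [leadAverage, survival_succ_succ, add_zero]; ring
  | succ k ih =>
    rw [leadAverage, ih, ih, leadAverage.eq_2 α m s (k + 1), leadAverage.eq_2 α m (s + 1) (k + 1),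
      show m + 1 + k + 1 = m + (k + 1) + 1 by ring]
    ring

section Iteration

variable {X : Type*} [NormedAddCommGroup X] [NormedSpace ℝ X]

lemma norm_sub_convexComb_le (u v w : X) {a : ℝ} (h₀ : 0 ≤ a) (h₁ : a ≤ 1) :
    ‖u - ((1 - a) • v + a • w)‖ ≤ (1 - a) * ‖u - v‖ + a * ‖u - w‖ := by
  have : u - ((1 - a) • v + a • w) = (1 - a) • (u - v) + a • (u - w) := by module
  rw [this]
  refine (norm_add_le _ _).trans_eq ?_
  rw [norm_smul_of_nonneg (by linarith), norm_smul_of_nonneg h₀]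

/-- The distances `‖y m - y n‖` and `‖y m - T (y n)‖`, for `m ≤ n`, are bounded by the averaged
survival probability of a lead of `0` and of `1`. -/
lemma norm_sub_le_leadAverage {C : Set X} {T : X → X} (hT : LipschitzOnWith 1 T C) {α : ℕ → ℝ}
    (h₀ : ∀ n, 0 ≤ α (n + 1)) (h₁ : ∀ n, α (n + 1) ≤ 1) {y : ℕ → X}
    (hy : ∀ n, y (n + 1) = (1 - α (n + 1)) • y n + α (n + 1) • T (y n))
    (hyC : ∀ n, y n ∈ C) {K : ℝ} (hK : ∀ n, ‖y 0 - T (y n)‖ ≤ K) (m : ℕ) :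
    (∀ k, ‖y m - y (m + k)‖ ≤ K * leadAverage α m k 0) ∧
      ∀ k, ‖y m - T (y (m + k))‖ ≤ K * leadAverage α m k 1 := by
  have first : ∀ m, (∀ k, ‖y m - T (y (m + k))‖ ≤ K * leadAverage α m k 1) →
      ∀ k, ‖y m - y (m + k)‖ ≤ K * leadAverage α m k 0 := by
    intro m h k
    induction k with
    | zero => simp [leadAverage]
    | succ k ih =>
      rw [leadAverage, ← add_assoc, hy]
      refine (norm_sub_convexComb_le _ _ _ (h₀ _) (h₁ _)).trans ?_
      have a := mul_le_mul_of_nonneg_left ih (sub_nonneg.2 (h₁ (m + k)))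
      have b := mul_le_mul_of_nonneg_left (h k) (h₀ (m + k))
      rw [zero_add]
      linarith
  induction m with
  | zero =>
    have second : ∀ k, ‖y 0 - T (y (0 + k))‖ ≤ K * leadAverage α 0 k 1 := fun k => by
      rw [leadAverage_zero_succ α k 0, mul_one]; exact hK _
    exact ⟨first 0 second, second⟩
  | succ m ih =>
    have second : ∀ k, ‖y (m + 1) - T (y (m + 1 + k))‖ ≤ K * leadAverage α (m + 1) k 1 := by
      intro k
      have e : m + 1 + k = m + (k + 1) := by ring
      rw [leadAverage_succ_succ α m k 0, e, norm_sub_rev, hy m]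
      refine (norm_sub_convexComb_le _ _ _ (h₀ _) (h₁ _)).trans ?_
      rw [norm_sub_rev _ (y m), norm_sub_rev _ (T (y m))]
      have hlip : ‖T (y m) - T (y (m + (k + 1)))‖ ≤ ‖y m - y (m + (k + 1))‖ := by
        simpa using hT.norm_sub_le (hyC m) (hyC (m + (k + 1)))
      have a := mul_le_mul_of_nonneg_left (ih.2 (k + 1)) (sub_nonneg.2 (h₁ m))
      have b := mul_le_mul_of_nonneg_left (hlip.trans (ih.1 (k + 1))) (h₀ m)
      rw [zero_add]
      linarith
    exact ⟨first _ second, second⟩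

/-- The residual is governed by the walk that starts with a lead of one fall: `T (y n)` is the
position of a player who has just fallen at `n + 1`. -/
lemma norm_sub_map_le_survival {C : Set X} {T : X → X} (hT : LipschitzOnWith 1 T C) {α : ℕ → ℝ}
    (h₀ : ∀ n, 0 ≤ α (n + 1)) (h₁ : ∀ n, α (n + 1) ≤ 1) {y : ℕ → X}
    (hy : ∀ n, y (n + 1) = (1 - α (n + 1)) • y n + α (n + 1) • T (y n))
    (hyC : ∀ n, y n ∈ C) {K : ℝ} (hK : ∀ n, ‖y 0 - T (y n)‖ ≤ K) (n : ℕ) :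
    ‖y n - T (y n)‖ ≤ K * survival α n 1 := by
  simpa [leadAverage] using (norm_sub_le_leadAverage hT h₀ h₁ hy hyC hK n).2 0

/-- The rate of the exact iteration, with a constant that depends only on the bound `K` and on
the lower bound `ε` of the step variances `2 * α n * (1 - α n)`. -/
lemma norm_sub_map_le_div_sqrt {C : Set X} {T : X → X} (hT : LipschitzOnWith 1 T C) {α : ℕ → ℝ}
    (h₀ : ∀ n, 0 ≤ α (n + 1)) (h₁ : ∀ n, α (n + 1) ≤ 1) {ε : ℝ} (hε : 0 < ε)
    (hα : ∀ n, ε ≤ 2 * (α (n + 1) * (1 - α (n + 1)))) {y : ℕ → X}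
    (hy : ∀ n, y (n + 1) = (1 - α (n + 1)) • y n + α (n + 1) • T (y n))
    (hyC : ∀ n, y n ∈ C) {K : ℝ} (hK : ∀ n, ‖y 0 - T (y n)‖ ≤ K) {n : ℕ} (hn : 1 ≤ n) :
    ‖y n - T (y n)‖ ≤ K * (4 / √(ε * n)) := by
  have hK0 : 0 ≤ K := (norm_nonneg _).trans (hK 0)
  have hn' : (0 : ℝ) < n := by exact_mod_cast hn
  refine (norm_sub_map_le_survival hT h₀ h₁ hy hyC hK n).trans
    (mul_le_mul_of_nonneg_left ?_ hK0)
  have hL1 : 1 ≤ √(4 + ε * n) := Real.one_le_sqrt.2 (by nlinarith [mul_pos hε hn'])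
  have h := survival_le_parabola hε.le h₀ h₁ hα n 1 (by simpa using hL1)
  have hLL : √(ε * n) ≤ √(4 + ε * n) := Real.sqrt_le_sqrt (by linarith)
  have hpos : 0 < √(ε * n) := Real.sqrt_pos.2 (by positivity)
  have h2 : 4 / √(4 + ε * n) ≤ 4 / √(ε * n) :=
    div_le_div_of_nonneg_left (by norm_num) hpos hLL
  refine h.trans (le_trans ?_ h2)
  push_cast
  have h3 : 4 / √(4 + ε * n) = 4 * (1 / √(4 + ε * n)) := by ring
  rw [h3]
  nlinarith [sq_nonneg (1 / √(4 + ε * n))]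

/-! ### Restarting the inexact iteration -/

/-- The exact iteration started at `u`, whose steps are `α (m + 1), α (m + 2), …`. -/
noncomputable def exactKM (T : X → X) (α : ℕ → ℝ) (m : ℕ) (u : X) : ℕ → X
  | 0 => u
  | k + 1 => (1 - α (m + (k + 1))) • exactKM T α m u k + α (m + (k + 1)) • T (exactKM T α m u k)

lemma exactKM_mem {C : Set X} (hC : Convex ℝ C) {T : X → X} (hTC : Set.MapsTo T C C) {α : ℕ → ℝ}
    (h₀ : ∀ n, 0 ≤ α (n + 1)) (h₁ : ∀ n, α (n + 1) ≤ 1) (m : ℕ) {u : X} (hu : u ∈ C) (k : ℕ) :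
    exactKM T α m u k ∈ C := by
  induction k with
  | zero => exact hu
  | succ k ih => exact hC ih (hTC ih) (sub_nonneg.2 (h₁ (m + k))) (h₀ (m + k)) (by ring)

lemma IsInexactKM.norm_sub_exactKM_le {C : Set X} (hC : Convex ℝ C) {T : X → X}
    (hTC : Set.MapsTo T C C) (hT : LipschitzOnWith 1 T C) {α : ℕ → ℝ} {e x : ℕ → X}
    (hx : IsInexactKM T α e x) (hxC : ∀ n, x n ∈ C)
    (h₀ : ∀ n, 0 ≤ α (n + 1)) (h₁ : ∀ n, α (n + 1) ≤ 1) (m k : ℕ) :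
    ‖x (m + k) - exactKM T α m (x m) k‖ ≤ ∑ j ∈ Finset.range k, ‖e (m + j + 1)‖ := by
  induction k with
  | zero => simp [exactKM]
  | succ k ih =>
    have hmem := exactKM_mem hC hTC h₀ h₁ m (hxC m) k
    have hlip := hT.norm_sub_le (hxC (m + k)) hmem
    rw [Finset.sum_range_succ, exactKM, ← add_assoc, hx (m + k)]
    generalize exactKM T α m (x m) k = z at *
    have a0 := h₀ (m + k)
    have a1 := h₁ (m + k)
    generalize α (m + k + 1) = a at *
    have : (1 - a) • x (m + k) + a • (T (x (m + k)) + e (m + k + 1)) - ((1 - a) • z + a • T z)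
        = (1 - a) • (x (m + k) - z) + a • (T (x (m + k)) - T z) + a • e (m + k + 1) := by module
    rw [this]
    refine (norm_add₃_le).trans ?_
    rw [norm_smul_of_nonneg (by linarith), norm_smul_of_nonneg a0, norm_smul_of_nonneg a0]
    simp only [NNReal.coe_one, one_mul] at hlip
    nlinarith [mul_le_mul_of_nonneg_left hlip a0,
      mul_le_mul_of_nonneg_right a1 (norm_nonneg (e (m + k + 1)))]

lemma IsInexactKM.norm_sub_zero_le {T : X → X} {α : ℕ → ℝ} {e x : ℕ → X}
    (hx : IsInexactKM T α e x) (h₀ : ∀ n, 0 ≤ α (n + 1)) (h₁ : ∀ n, α (n + 1) ≤ 1)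
    {κ E : ℝ} (hκ : ∀ n, ‖T (x n) - x 0‖ ≤ κ) (hE : ∀ n, ‖e (n + 1)‖ ≤ E) (n : ℕ) :
    ‖x 0 - x n‖ ≤ κ + E := by
  induction n with
  | zero => simpa using add_nonneg ((norm_nonneg _).trans (hκ 0)) ((norm_nonneg _).trans (hE 0))
  | succ n ih =>
    rw [hx n]
    refine (norm_sub_convexComb_le _ _ _ (h₀ n) (h₁ n)).trans ?_
    have h : ‖x 0 - (T (x n) + e (n + 1))‖ ≤ κ + E := by
      rw [norm_sub_rev, add_sub_right_comm]
      exact (norm_add_le _ _).trans (add_le_add (hκ n) (hE n))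
    nlinarith [mul_le_mul_of_nonneg_left ih (sub_nonneg.2 (h₁ n)),
      mul_le_mul_of_nonneg_left h (h₀ n)]

/-- The residual is at most `ν / √n` plus twice the errors made in the second half of the
iteration. -/
lemma IsInexactKM.exists_residual_le {C : Set X} (hC : Convex ℝ C) {T : X → X}
    (hTC : Set.MapsTo T C C) (hT : LipschitzOnWith 1 T C) {α : ℕ → ℝ} {e x : ℕ → X}
    (hx : IsInexactKM T α e x) (h0 : AssumptionH0 C T x)
    (he : Summable (fun k : ℕ => ‖e (k + 1)‖)) (hα : BoundedAwayFromZeroOne α) :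
    ∃ ν : ℝ, 0 ≤ ν ∧ ∀ n : ℕ, 1 ≤ n → ‖x n - T (x n)‖ ≤
      ν / √(n : ℝ) + 2 * ∑ j ∈ Finset.range (n - n / 2), ‖e (n / 2 + j + 1)‖ := by
  obtain ⟨κ, hκ0, hκ⟩ := h0
  obtain ⟨c, hc, hαc⟩ := hα
  have hαc' : ∀ n, c ≤ α (n + 1) ∧ α (n + 1) ≤ 1 - c := fun n => hαc _ (by omega)
  have h₀ : ∀ n, 0 ≤ α (n + 1) := fun n => by linarith [hαc' n]
  have h₁ : ∀ n, α (n + 1) ≤ 1 := fun n => by linarith [hαc' n]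
  have hxC := fun n => (hκ n).1
  set E := ∑' k, ‖e (k + 1)‖
  have hE0 : 0 ≤ E := tsum_nonneg fun _ => norm_nonneg _
  have hsum : ∀ m k, ∑ j ∈ Finset.range k, ‖e (m + j + 1)‖ ≤ E := by
    intro m k
    refine le_trans ?_ (he.sum_le_tsum (Finset.range (m + k)) fun _ _ => norm_nonneg _)
    rw [Finset.sum_range_add]
    exact le_add_of_nonneg_left (Finset.sum_nonneg fun _ _ => norm_nonneg _)
  have hE : ∀ n, ‖e (n + 1)‖ ≤ E := fun n => he.le_tsum n fun _ _ => norm_nonneg _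
  set ε := 2 * (c * (1 - c))
  have hε : 0 < ε := by
    have := hαc' 0
    have : 0 < 1 - c := by linarith
    positivity
  have hαε : ∀ n, ε ≤ 2 * (α (n + 1) * (1 - α (n + 1))) := fun n => by
    nlinarith [mul_nonneg (sub_nonneg.2 (hαc' n).1) (sub_nonneg.2 (hαc' n).2)]
  set K := 2 * (κ + E)
  have hK0 : 0 ≤ K := by positivity
  -- the restarted iteration makes at least `n / 2` steps, whence `ε / 2`
  refine ⟨K * (4 / √(ε / 2)), by positivity, fun n hn => ?_⟩
  obtain ⟨m, k, hm, hk, hk1⟩ : ∃ m k, n / 2 = m ∧ n = m + k ∧ n ≤ 2 * k :=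
    ⟨n / 2, n - n / 2, rfl, by omega, by omega⟩
  rw [hm, show n - m = k by omega]
  set y := exactKM T α m (x m)
  have hyC : ∀ j, y j ∈ C := exactKM_mem hC hTC h₀ h₁ m (hxC m)
  have hdist : ∀ j, ‖x (m + j) - y j‖ ≤ ∑ i ∈ Finset.range j, ‖e (m + i + 1)‖ :=
    hx.norm_sub_exactKM_le hC hTC hT hxC h₀ h₁ m
  have hlip : ∀ j, ‖T (x (m + j)) - T (y j)‖ ≤ ‖x (m + j) - y j‖ := fun j => by
    simpa using hT.norm_sub_le (hxC (m + j)) (hyC j)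
  have hyK : ∀ j, ‖y 0 - T (y j)‖ ≤ K := by
    intro j
    have a := hx.norm_sub_zero_le h₀ h₁ (fun n => (hκ n).2) hE m
    have b := (hκ (m + j)).2
    have d := ((hlip j).trans (hdist j)).trans (hsum m j)
    have : y 0 - T (y j) = -(x 0 - x m) - (T (x (m + j)) - x 0)
        + (T (x (m + j)) - T (y j)) := by
      change x m - T (y j) = _
      abel
    rw [this]
    have t1 := norm_add_le (-(x 0 - x m) - (T (x (m + j)) - x 0)) (T (x (m + j)) - T (y j))
    have t2 := norm_sub_le (-(x 0 - x m)) (T (x (m + j)) - x 0)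
    rw [norm_neg] at t2
    simp only [K]
    linarith
  have hres := norm_sub_map_le_div_sqrt (α := fun i => α (m + i)) hT (fun i => h₀ (m + i))
    (fun i => h₁ (m + i)) hε (fun i => hαε (m + i)) (fun i => rfl) hyC hyK (n := k) (by omega)
  have hsqrt : 4 / √(ε * k) ≤ 4 / √(ε / 2) / √(n : ℝ) := by
    have hn' : (0 : ℝ) < n := by exact_mod_cast hn
    have hnk : (n : ℝ) ≤ 2 * k := by exact_mod_cast hk1
    rw [div_div, ← Real.sqrt_mul (by positivity)]
    refine div_le_div_of_nonneg_left (by norm_num) (Real.sqrt_pos.2 (by positivity))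
      (Real.sqrt_le_sqrt ?_)
    nlinarith
  have hmain : ‖x n - T (x n)‖ ≤ ‖y k - T (y k)‖ + 2 * ‖x (m + k) - y k‖ := by
    rw [← hk]
    have : x n - T (x n) = (x n - y k) + (y k - T (y k)) - (T (x n) - T (y k)) := by abel
    rw [this]
    have hl := hlip k
    rw [← hk] at hl
    linarith [norm_sub_le ((x n - y k) + (y k - T (y k))) (T (x n) - T (y k)),
      norm_add_le (x n - y k) (y k - T (y k))]
  have := mul_le_mul_of_nonneg_left hsqrt hK0
  rw [mul_div_assoc]
  linarith [hdist k]

end Iteration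

theorem theorem2 {X : Type*} [NormedAddCommGroup X] [NormedSpace ℝ X] [CompleteSpace X]
    (C : Set X) (hC_closed : IsClosed C) (hC_convex : Convex ℝ C)
    (T : X → X) (hT_maps : Set.MapsTo T C C) (hT_nonexp : LipschitzOnWith 1 T C)
    (α : ℕ → ℝ) (e x : ℕ → X)
    (hx : IsInexactKM T α e x)
    (h0 : AssumptionH0 C T x)
    (he : Summable (fun k : ℕ => ‖e (k + 1)‖))
    (hα : BoundedAwayFromZeroOne α) :
    (∃ ν : ℝ, 0 ≤ ν ∧
      (∀ n : ℕ, 1 ≤ n →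
        ‖x n - T (x n)‖ ≤
          ν / √(n : ℝ) + ∑' i : {i : ℕ // 1 ≤ i ∧ n / 2 ≤ i}, 2 * ‖e i‖) ∧
      (∀ (φ : ℝ≥0 → ℝ≥0) (μ : ℝ), Monotone φ →
        HasSum (fun k : ℕ => (φ ((k + 1 : ℕ) : ℝ≥0) : ℝ) * ‖e (k + 1)‖) μ →
        ∀ n : ℕ, 1 ≤ n → 0 < φ ((n / 2 : ℕ) : ℝ≥0) →
          ‖x n - T (x n)‖ ≤ ν / √(n : ℝ) + 2 * μ / (φ ((n / 2 : ℕ) : ℝ≥0) : ℝ))) ∧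
    (∀ a : ℝ, 0 ≤ a →
      Summable (fun k : ℕ => ((k + 1 : ℕ) : ℝ) ^ a * ‖e (k + 1)‖) →
      (fun n : ℕ => ‖x n - T (x n)‖) =O[atTop]
        (fun n : ℕ => 1 / (n : ℝ) ^ (min (1 / 2 : ℝ) a))) := by
  obtain ⟨ν, hν, hres⟩ := hx.exists_residual_le hC_convex hT_maps hT_nonexp h0 he hα
  have weighted : ∀ (φ : ℝ≥0 → ℝ≥0) (μ : ℝ), Monotone φ →
      HasSum (fun k : ℕ => (φ ((k + 1 : ℕ) : ℝ≥0) : ℝ) * ‖e (k + 1)‖) μ →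
      ∀ n : ℕ, 1 ≤ n → 0 < φ ((n / 2 : ℕ) : ℝ≥0) →
        ‖x n - T (x n)‖ ≤ ν / √(n : ℝ) + 2 * μ / (φ ((n / 2 : ℕ) : ℝ≥0) : ℝ) := by
    intro φ μ hφ hμ n hn hpos
    refine (hres n hn).trans (add_le_add le_rfl ?_)
    rw [mul_div_assoc]
    refine mul_le_mul_of_nonneg_left ?_ zero_le_two
    rw [le_div_iff₀ (by exact_mod_cast hpos), Finset.sum_mul]
    refine le_trans (Finset.sum_le_sum (g := fun j => (φ ((n / 2 + j + 1 : ℕ) : ℝ≥0) : ℝ)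
      * ‖e (n / 2 + j + 1)‖) fun j _ => ?_) ?_
    · rw [mul_comm]
      refine mul_le_mul_of_nonneg_right ?_ (norm_nonneg _)
      exact_mod_cast hφ (Nat.cast_le.2 (by omega : n / 2 ≤ n / 2 + j + 1))
    · refine le_trans ?_ (sum_le_hasSum (Finset.range (n / 2 + (n - n / 2)))
        (fun _ _ => by positivity) hμ)
      rw [Finset.sum_range_add]
      exact le_add_of_nonneg_left (Finset.sum_nonneg fun _ _ => by positivity)
  refine ⟨⟨ν, hν, fun n hn => ?_, weighted⟩, fun a ha hsum => ?_⟩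
  · refine (hres n hn).trans (add_le_add le_rfl ?_)
    have hs : Summable fun i : {i : ℕ // 1 ≤ i ∧ n / 2 ≤ i} => 2 * ‖e i‖ :=
      (((summable_nat_add_iff (f := fun k => ‖e k‖) 1).1 he).subtype _).mul_left 2
    let g : ℕ ↪ {i : ℕ // 1 ≤ i ∧ n / 2 ≤ i} :=
      ⟨fun j => ⟨n / 2 + j + 1, by omega, by omega⟩, fun i j h => by
        have := congrArg Subtype.val h
        simp only at this
        omega⟩
    have := hs.sum_le_tsum ((Finset.range (n - n / 2)).map g) fun _ _ => by positivity
    rw [Finset.sum_map] at this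
    rw [Finset.mul_sum]
    exact this
  · obtain ⟨μ, hμ⟩ := hsum
    have hμ0 : 0 ≤ μ := hμ.nonneg fun _ => by positivity
    have hw := weighted (fun t => t ^ a) μ (NNReal.monotone_rpow_of_nonneg ha)
      (by simpa only [NNReal.coe_rpow, NNReal.coe_natCast] using hμ)
    refine IsBigO.of_bound (ν + 2 * μ * 3 ^ a) ?_
    filter_upwards [eventually_ge_atTop 2] with n hn
    have hn1 : (1 : ℝ) ≤ n := by exact_mod_cast (by omega : 1 ≤ n)
    have hhalf : (n : ℝ) / 3 ≤ ((n / 2 : ℕ) : ℝ) := by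
      rw [div_le_iff₀ (by norm_num)]
      exact_mod_cast (by omega : n ≤ n / 2 * 3)
    have hhalf0 : 0 < ((n / 2 : ℕ) : ℝ≥0) := by exact_mod_cast (by omega : 0 < n / 2)
    have h := hw n (by omega) (NNReal.rpow_pos hhalf0)
    simp only [NNReal.coe_rpow, NNReal.coe_natCast] at h
    rw [Real.norm_of_nonneg (norm_nonneg _), Real.norm_of_nonneg (by positivity)]
    set b := min (1 / 2 : ℝ) a
    have hnb : (0 : ℝ) < (n : ℝ) ^ b := by positivity
    have p1 : ν / √(n : ℝ) ≤ ν / (n : ℝ) ^ b := by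
      rw [Real.sqrt_eq_rpow]
      exact div_le_div_of_nonneg_left hν hnb
        (Real.rpow_le_rpow_of_exponent_le hn1 (min_le_left _ _))
    have p2 : 2 * μ / ((n / 2 : ℕ) : ℝ) ^ a ≤ 2 * μ * 3 ^ a / (n : ℝ) ^ b := by
      have q1 : ((n : ℝ) / 3) ^ a ≤ ((n / 2 : ℕ) : ℝ) ^ a :=
        Real.rpow_le_rpow (by positivity) hhalf ha
      have q2 : (n : ℝ) ^ b ≤ (n : ℝ) ^ a :=
        Real.rpow_le_rpow_of_exponent_le hn1 (min_le_right _ _)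
      rw [Real.div_rpow (by positivity) (by norm_num)] at q1
      calc 2 * μ / ((n / 2 : ℕ) : ℝ) ^ a ≤ 2 * μ / ((n : ℝ) ^ a / 3 ^ a) :=
            div_le_div_of_nonneg_left (by positivity) (by positivity) q1
        _ = 2 * μ * 3 ^ a / (n : ℝ) ^ a := by field_simp
        _ ≤ _ := div_le_div_of_nonneg_left (by positivity) hnb q2
    calc _ ≤ _ := h
      _ ≤ ν / (n : ℝ) ^ b + 2 * μ * 3 ^ a / (n : ℝ) ^ b := add_le_add p1 p2
      _ = _ := by ring
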